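/- Let $(X_n)_{n\ge 1}$ be a strictly stationary, 1-dependent sequence of real random variables (that is, for every $t\ge 1$ the $\sigma$-algebras $\sigma(X_1,\dots,X_t)$ and $\sigma(X_{t+2},X_{t+3},\dots)$ are independent). For $x\in\mathbb R$ put $$p_n=P(\min\{X_1,\dots,X_n\}>x),\quad q_n=P(\max\{X_1,\dots,X_n\}\le x)\quad(n\ge1),\qquad p_0=1,$$ $$C(z)=1+\sum_{k=1}^{\infty}(-1)^k p_{k-1}z^k .$$ Suppose that $0<p_1\le\alpha\le 0.1$. Let $t_2=t_2(\alpha)$ be the second root, in increasing order, of the equation $\alpha t^3-t+1=0$ (which has three distinct real roots, of which $t_2$ is the smallest positive one). Let $l>t_2^3$, put $\eta=1+l\alpha$, and suppose that $l$ is close enough to $t_2^3$ for $$(1-\alpha\eta^2)^2-\alpha\eta^2(1+\eta-2\alpha\eta)^2>0$$ to hold (it then follows that all denominators below are positive). Then $C$ has exactly one zero $\lambda$ in the interval $(1,1+lp_1)$, and for every $n\ge 3$ $$\bigl|q_n\lambda^n-(1-p_2+2p_3-3p_4+p_1^2+6p_2^2-6p_1p_2)\bigr|\le\Gamma(\alpha)\,p_1^3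 ,$$ where $\Gamma(\alpha)=L(\alpha)+E(\alpha)$ with $$K(\alpha)=\frac{\dfrac{11-3\alpha}{(1-\alpha)^2}+2l(1+3\alpha)\dfrac{2+3l\alpha-\alpha(2-l\alpha)(1+l\alpha)^2}{[1-\alpha(1+l\alpha)^2]^3}}{1-\dfrac{2\alpha(1+l\alpha)}{[1-\alpha(1+l\alpha)^2]^2}},$$ $$L(\alpha)=3K(\alpha)(1+\alpha+3\alpha^2)\bigl[1+\alpha+3\alpha^2+K(\alpha)\alpha^3\bigr]+\alpha^6K(\alpha)^3+9\alpha(4+3\alpha+3\alpha^2)+55,$$ $$E(\alpha)=0.1+\frac{\eta^5[1+(1-2\alpha)\eta]^4[1+\alpha(\eta-2)][1+\eta+(1-3\alpha)\eta^2]}{2(1-\alpha\eta^2)^4\bigl[(1-\alpha\eta^2)^2-\alpha\eta^2(1+\eta-2\alpha\eta)^2\bigr]} .$$ -/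

import Mathlib

open MeasureTheory ProbabilityTheory

namespace OneDependent

/-- Strict stationarity of a sequence of real random variables: every finite block
`(X (m), …, X (m + k - 1))` has the same law as `(X 0, …, X (k - 1))`. -/
def IsStrictlyStationary {Ω : Type*} [MeasurableSpace Ω] (μ : Measure Ω) (X : ℕ → Ω → ℝ) : Prop :=
  ∀ m k : ℕ, μ.map (fun ω (i : Fin k) => X (m + i) ω) = μ.map (fun ω (i : Fin k) => X i ω)

/-- 1-dependence: for every `t`, the σ-algebra generated by the variables of index `≤ t` and the
one generated by the variables of index `≥ t + 2` are independent. -/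
def IsOneDependent {Ω : Type*} [MeasurableSpace Ω] (μ : Measure Ω) (X : ℕ → Ω → ℝ) : Prop :=
  ∀ t : ℕ, Indep
    (⨆ i ∈ {i : ℕ | i ≤ t}, MeasurableSpace.comap (X i) inferInstance)
    (⨆ i ∈ {i : ℕ | t + 2 ≤ i}, MeasurableSpace.comap (X i) inferInstance) μ

/-- `p_n(x)`, the probability that the minimum of the first `n` variables `X 0, …, X (n - 1)`
exceeds `x`, that is, that each of them does. For `n = 0` this is `1`. -/
noncomputable def p {Ω : Type*} [MeasurableSpace Ω] (μ : Measure Ω) (X : ℕ → Ω → ℝ)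
    (x : ℝ) (n : ℕ) : ℝ :=
  μ.real {ω | ∀ i < n, x < X i ω}

/-- `q_n(x)`, the probability that the maximum of the first `n` variables `X 0, …, X (n - 1)`
is at most `x`, that is, that each of them is. -/
noncomputable def q {Ω : Type*} [MeasurableSpace Ω] (μ : Measure Ω) (X : ℕ → Ω → ℝ)
    (x : ℝ) (n : ℕ) : ℝ :=
  μ.real {ω | ∀ i < n, X i ω ≤ x}

/-- The series `C_x(z) = 1 + ∑_{k ≥ 1} (-1)^k p_{k-1}(x) z^k`. (Where the series does not converge absolutely
the value is `1`, so a zero of this function is always a point of convergence.) -/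
noncomputable def C {Ω : Type*} [MeasurableSpace Ω] (μ : Measure Ω) (X : ℕ → Ω → ℝ)
    (x z : ℝ) : ℝ :=
  1 + ∑' k : ℕ, (-1) ^ (k + 1) * p μ X x k * z ^ (k + 1)

/-- `t₂` is the second, in increasing order, of three real roots of `α t³ - t + 1 = 0`. -/
def IsSecondRoot (α t₂ : ℝ) : Prop :=
  α * t₂ ^ 3 - t₂ + 1 = 0 ∧
    ∃ t₁ t₃ : ℝ, t₁ < t₂ ∧ t₂ < t₃ ∧ α * t₁ ^ 3 - t₁ + 1 = 0 ∧ α * t₃ ^ 3 - t₃ + 1 = 0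

/-- `K(α)`, for a given value of `l`. -/
noncomputable def K (α l : ℝ) : ℝ :=
  ((11 - 3 * α) / (1 - α) ^ 2 +
      2 * l * (1 + 3 * α) *
        ((2 + 3 * l * α - α * (2 - l * α) * (1 + l * α) ^ 2) /
          (1 - α * (1 + l * α) ^ 2) ^ 3)) /
    (1 - 2 * α * (1 + l * α) / (1 - α * (1 + l * α) ^ 2) ^ 2)

/-- `L(α)`, for a given value of `l`. -/
noncomputable def L (α l : ℝ) : ℝ :=
  3 * K α l * (1 + α + 3 * α ^ 2) * (1 + α + 3 * α ^ 2 + K α l * α ^ 3) + α ^ 6 * K α l ^ 3 +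
    9 * α * (4 + 3 * α + 3 * α ^ 2) + 55

/-- The bracket `(1 - α η²)² - α η² (1 + η - 2 α η)²` in the denominator of `E(α)`. -/
def bracket (α η : ℝ) : ℝ :=
  (1 - α * η ^ 2) ^ 2 - α * η ^ 2 * (1 + η - 2 * α * η) ^ 2

/-- `E(α)`, as a function of `α` and `η = 1 + l α`. -/
noncomputable def E (α η : ℝ) : ℝ :=
  0.1 + η ^ 5 * (1 + (1 - 2 * α) * η) ^ 4 * (1 + α * (η - 2)) * (1 + η + (1 - 3 * α) * η ^ 2) /
    (2 * (1 - α * η ^ 2) ^ 4 * bracket α η)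

/-- `Γ(α) = L(α) + E(α)`, for a given value of `l`, with `η = 1 + l α`. -/
noncomputable def Gam (α l : ℝ) : ℝ :=
  L α l + E α (1 + l * α)

end OneDependent

namespace OneDependent

section Probability

variable {Ω : Type*} {X : ℕ → Ω → ℝ} {x : ℝ}

lemma measurableSet_forall_le_past (s : Set ℝ) (hs : MeasurableSet s) (t : ℕ) :
    MeasurableSet[⨆ i ∈ {i : ℕ | i ≤ t}, MeasurableSpace.comap (X i) inferInstance]
      {ω | ∀ i < t + 1, X i ω ∈ s} := by
  have : {ω | ∀ i < t + 1, X i ω ∈ s} = ⋂ i ∈ {i : ℕ | i ≤ t}, X i ⁻¹' s := by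
    ext ω; simp
  rw [this]
  refine MeasurableSet.biInter (Set.to_countable _) fun i hi => ?_
  exact le_iSup₂ (f := fun i (_ : i ∈ {i : ℕ | i ≤ t}) =>
    MeasurableSpace.comap (X i) inferInstance) i hi _ ⟨s, hs, rfl⟩

lemma measurableSet_forall_future (s : Set ℝ) (hs : MeasurableSet s) (t b : ℕ) :
    MeasurableSet[⨆ i ∈ {i : ℕ | t + 2 ≤ i}, MeasurableSpace.comap (X i) inferInstance]
      {ω | ∀ i < b, X (t + 2 + i) ω ∈ s} := by
  have : {ω | ∀ i < b, X (t + 2 + i) ω ∈ s} = ⋂ i ∈ {i : ℕ | i < b}, X (t + 2 + i) ⁻¹' s := by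
    ext ω; simp
  rw [this]
  refine MeasurableSet.biInter (Set.to_countable _) fun i _ => ?_
  exact le_iSup₂ (f := fun i (_ : i ∈ {i : ℕ | t + 2 ≤ i}) =>
    MeasurableSpace.comap (X i) inferInstance) (t + 2 + i) (Nat.le_add_right _ _) _ ⟨s, hs, rfl⟩

variable [MeasurableSpace Ω] {μ : Measure Ω}

/-- The probability that the first `a` variables are at most `x` and the next `b` exceed `x`. -/
noncomputable def lowHigh (μ : Measure Ω) (X : ℕ → Ω → ℝ) (x : ℝ) (a b : ℕ) : ℝ :=
  μ.real {ω | (∀ i < a, X i ω ≤ x) ∧ ∀ i < b, x < X (a + i) ω}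

lemma measurableSet_forall_lt (hmeas : ∀ i, Measurable (X i)) {s : Set ℝ} (hs : MeasurableSet s)
    (m b : ℕ) : MeasurableSet {ω | ∀ i < b, X (m + i) ω ∈ s} := by
  have : {ω | ∀ i < b, X (m + i) ω ∈ s} = ⋂ i ∈ {i : ℕ | i < b}, X (m + i) ⁻¹' s := by
    ext ω; simp
  rw [this]
  exact MeasurableSet.biInter (Set.to_countable _) fun i _ => hmeas _ hs

lemma IsOneDependent.measureReal_inter (hdep : IsOneDependent μ X) {s s' : Set ℝ}
    (hs : MeasurableSet s) (hs' : MeasurableSet s') (t b : ℕ) :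
    μ.real {ω | (∀ i < t + 1, X i ω ∈ s) ∧ ∀ i < b, X (t + 2 + i) ω ∈ s'} =
      μ.real {ω | ∀ i < t + 1, X i ω ∈ s} * μ.real {ω | ∀ i < b, X (t + 2 + i) ω ∈ s'} := by
  have h := (Indep_iff _ _ _).1 (hdep t) _ _ (measurableSet_forall_le_past s hs t)
    (measurableSet_forall_future s' hs' t b)
  simp only [measureReal_def, ← ENNReal.toReal_mul, ← h]
  rfl

lemma IsStrictlyStationary.measureReal_shift (hmeas : ∀ i, Measurable (X i))
    (hstat : IsStrictlyStationary μ X) {s : Set ℝ} (hs : MeasurableSet s) (m b : ℕ) :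
    μ.real {ω | ∀ i < b, X (m + i) ω ∈ s} = μ.real {ω | ∀ i < b, X i ω ∈ s} := by
  have hB : MeasurableSet {y : Fin b → ℝ | ∀ i, y i ∈ s} := by
    have : {y : Fin b → ℝ | ∀ i, y i ∈ s} = Set.pi Set.univ fun _ => s := by ext; simp
    rw [this]
    exact MeasurableSet.univ_pi fun _ => hs
  have h := congrArg (fun ν => ν.real {y : Fin b → ℝ | ∀ i, y i ∈ s}) (hstat m b)
  rw [map_measureReal_apply (measurable_pi_lambda _ fun i => hmeas _) hB,
    map_measureReal_apply (measurable_pi_lambda _ fun i => hmeas _) hB] at h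
  convert h using 2 <;> ext ω <;> simp [Fin.forall_iff]

lemma p_nonneg (n : ℕ) : 0 ≤ p μ X x n := measureReal_nonneg

lemma measureReal_forall_shift (hmeas : ∀ i, Measurable (X i)) (hstat : IsStrictlyStationary μ X)
    (m n : ℕ) : μ.real {ω | ∀ i < n, x < X (m + i) ω} = p μ X x n :=
  hstat.measureReal_shift hmeas measurableSet_Ioi m n

variable [IsProbabilityMeasure μ]

lemma p_zero : p μ X x 0 = 1 := by simp [p]

lemma q_zero : q μ X x 0 = 1 := by simp [q]

lemma p_succ_le (n : ℕ) : p μ X x (n + 1) ≤ p μ X x n :=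
  measureReal_mono (fun _ h i hi => h i (hi.trans n.lt_succ_self))

lemma p_add_two_le (hmeas : ∀ i, Measurable (X i)) (hstat : IsStrictlyStationary μ X)
    (hdep : IsOneDependent μ X) (k : ℕ) : p μ X x (k + 2) ≤ p μ X x 1 * p μ X x k := by
  rcases k with _ | k
  · simpa [p_zero] using p_succ_le (μ := μ) (X := X) (x := x) 1
  · have h := hdep.measureReal_inter (μ := μ) (X := X) (s := Set.Ioi x) (s' := Set.Ioi x)
      measurableSet_Ioi measurableSet_Ioi k 1
    have h' := measureReal_forall_shift (x := x) hmeas hstat (k + 2) 1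
    simp only [Set.mem_Ioi] at h
    rw [h', mul_comm] at h
    refine le_of_le_of_eq (measureReal_mono ?_) h
    intro ω hω
    refine ⟨fun i hi => hω i (by omega), fun i hi => hω _ (by omega)⟩

lemma two_mul_p_two_le (hmeas : ∀ i, Measurable (X i)) (hstat : IsStrictlyStationary μ X) :
    2 * p μ X x 2 ≤ p μ X x 1 + p μ X x 3 := by
  set A : Set Ω := {ω | ∀ i < 2, x < X (0 + i) ω} with hA
  set B : Set Ω := {ω | ∀ i < 2, x < X (1 + i) ω} with hB
  have hAp : μ.real A = p μ X x 2 := measureReal_forall_shift hmeas hstat 0 2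
  have hBp : μ.real B = p μ X x 2 := measureReal_forall_shift hmeas hstat 1 2
  have hBm : MeasurableSet B := measurableSet_forall_lt hmeas measurableSet_Ioi 1 2
  have h := measureReal_union_add_inter (μ := μ) (s := A) hBm
  have h1 : μ.real (A ∪ B) ≤ p μ X x 1 := by
    rw [← measureReal_forall_shift hmeas hstat 1 1]
    refine measureReal_mono ?_
    rintro ω (hω | hω) i hi
    · have : i = 0 := by omega
      subst this; exact hω 1 (by norm_num)
    · exact hω i (by omega)
  have h2 : μ.real (A ∩ B) ≤ p μ X x 3 := by
    refine measureReal_mono ?_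
    rintro ω ⟨h1, h2⟩ i hi
    rcases i with _ | i
    · exact h1 0 (by norm_num)
    · simpa [add_comm] using h2 i (by omega)
  linarith

lemma q_mul_p (hmeas : ∀ i, Measurable (X i)) (hstat : IsStrictlyStationary μ X)
    (hdep : IsOneDependent μ X) (a b : ℕ) :
    q μ X x a * p μ X x b = lowHigh μ X x (a + 1) b + lowHigh μ X x a (b + 1) := by
  have key : q μ X x a * p μ X x b =
      μ.real {ω | (∀ i < a, X i ω ≤ x) ∧ ∀ i < b, x < X (a + 1 + i) ω} := by
    rcases a with _ | t
    · simpa [q_zero] using (measureReal_forall_shift hmeas hstat (0 + 1) b).symm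
    · rw [← measureReal_forall_shift hmeas hstat (t + 2) b]
      exact (hdep.measureReal_inter (s := Set.Iic x) (s' := Set.Ioi x)
        measurableSet_Iic measurableSet_Ioi t b).symm
  rw [key, lowHigh, lowHigh, ← measureReal_inter_add_sdiff (s := {ω | (∀ i < a, X i ω ≤ x) ∧
    ∀ i < b, x < X (a + 1 + i) ω}) (t := {ω | X a ω ≤ x}) (hmeas a measurableSet_Iic)]
  congr 2
  · ext ω
    simp only [Set.mem_inter_iff, Set.mem_ofPred_eq, Nat.forall_lt_succ_right]
    tauto
  · ext ω
    simp only [Set.mem_sdiff, Set.mem_ofPred_eq, Nat.forall_lt_succ_left, not_le, add_zero]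
    have : ∀ i, a + 1 + i = a + (i + 1) := fun i => by ring
    simp only [this]
    tauto

lemma sum_range_alternating_add (f : ℕ → ℝ) (n : ℕ) :
    ∑ j ∈ Finset.range n, (-1) ^ j * (f j + f (j + 1)) = f 0 - (-1) ^ n * f n := by
  induction n with
  | zero => simp
  | succ n ih => rw [Finset.sum_range_succ, ih]; ring

lemma q_eq_sum (hmeas : ∀ i, Measurable (X i)) (hstat : IsStrictlyStationary μ X)
    (hdep : IsOneDependent μ X) (n : ℕ) :
    q μ X x n = (-1) ^ n * p μ X x n +
      ∑ j ∈ Finset.range n, (-1) ^ j * (p μ X x j * q μ X x (n - 1 - j)) := by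
  have h := sum_range_alternating_add (fun j => lowHigh μ X x (n - j) j) n
  have h0 : lowHigh μ X x n 0 = q μ X x n := by simp [lowHigh, q]
  have hn : lowHigh μ X x 0 n = p μ X x n := by simp [lowHigh, p]
  simp only [Nat.sub_zero, Nat.sub_self, h0, hn] at h
  have h' : ∑ j ∈ Finset.range n, (-1) ^ j * (p μ X x j * q μ X x (n - 1 - j)) =
      ∑ j ∈ Finset.range n,
        (-1) ^ j * (lowHigh μ X x (n - j) j + lowHigh μ X x (n - (j + 1)) (j + 1)) := by
    refine Finset.sum_congr rfl fun j hj => ?_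
    have hj := Finset.mem_range.1 hj
    rw [mul_comm (p μ X x j), q_mul_p hmeas hstat hdep,
      show n - 1 - j + 1 = n - j by omega, show n - 1 - j = n - (j + 1) by omega]
  rw [h', h]
  ring

end Probability

/-- The properties of the sequence `n ↦ P(min(X₁, …, Xₙ) > x)` used below. -/
structure IsMinTail (a : ℕ → ℝ) : Prop where
  zero : a 0 = 1
  nonneg (n : ℕ) : 0 ≤ a n
  succ_le (n : ℕ) : a (n + 1) ≤ a n
  add_two_le (n : ℕ) : a (n + 2) ≤ a 1 * a n

/-- The alternating series `∑ (-1)^i a_{m+i} z^i`. -/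
noncomputable def altSeries (a : ℕ → ℝ) (m : ℕ) (z : ℝ) : ℝ :=
  ∑' i : ℕ, (-1) ^ i * a (m + i) * z ^ i

namespace IsMinTail

variable {a : ℕ → ℝ}

lemma antitone (h : IsMinTail a) : Antitone a := antitone_nat_of_succ_le h.succ_le

lemma add_two_mul_le (h : IsMinTail a) (m i : ℕ) : a (m + 2 * i) ≤ a m * a 1 ^ i := by
  induction i with
  | zero => simp
  | succ i ih =>
    calc a (m + 2 * (i + 1)) ≤ a 1 * a (m + 2 * i) := h.add_two_le _
      _ ≤ a 1 * (a m * a 1 ^ i) := mul_le_mul_of_nonneg_left ih (h.nonneg 1)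
      _ = _ := by ring

lemma two_mul_le (h : IsMinTail a) (i : ℕ) : a (2 * i) ≤ a 1 ^ i := by
  simpa [h.zero] using h.add_two_mul_le 0 i

lemma summable_mul_pow (h : IsMinTail a) (m : ℕ) {z : ℝ} (hz : 0 ≤ z) (hz1 : a 1 * z ^ 2 < 1) :
    Summable fun i => a (m + i) * z ^ i := by
  have h0 := h.nonneg
  have hg : Summable fun i : ℕ => (a 1 * z ^ 2) ^ i :=
    summable_geometric_of_lt_one (mul_nonneg (h0 1) (sq_nonneg z)) hz1
  have hle (i : ℕ) : a (m + 2 * i) * z ^ (2 * i) ≤ (a 1 * z ^ 2) ^ i := by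
    rw [mul_pow, ← pow_mul]
    exact mul_le_mul_of_nonneg_right ((h.antitone (Nat.le_add_left _ _)).trans (h.two_mul_le i))
      (by positivity)
  have he : Summable fun i => a (m + 2 * i) * z ^ (2 * i) :=
    Summable.of_nonneg_of_le (fun i => mul_nonneg (h0 _) (by positivity)) hle hg
  have ho : Summable fun i => a (m + (2 * i + 1)) * z ^ (2 * i + 1) := by
    refine Summable.of_nonneg_of_le (fun i => mul_nonneg (h0 _) (by positivity)) (fun i => ?_)
      (hg.mul_left z)
    calc a (m + (2 * i + 1)) * z ^ (2 * i + 1) = z * (a (m + 2 * i + 1) * z ^ (2 * i)) := by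
          rw [add_assoc]; ring
      _ ≤ z * (a (m + 2 * i) * z ^ (2 * i)) := by
          gcongr
          exact h.succ_le _
      _ ≤ _ := mul_le_mul_of_nonneg_left (hle i) hz
  exact (HasSum.even_add_odd (f := fun i => a (m + i) * z ^ i) he.hasSum ho.hasSum).summable

lemma summable_alt (h : IsMinTail a) (m : ℕ) {z : ℝ} (hz : 0 ≤ z) (hz1 : a 1 * z ^ 2 < 1) :
    Summable fun i => (-1) ^ i * a (m + i) * z ^ i := by
  refine Summable.of_abs ((h.summable_mul_pow m hz hz1).congr fun i => ?_)
  rw [abs_mul, abs_mul, abs_pow, abs_neg, abs_one, one_pow, one_mul, abs_of_nonneg (h.nonneg _),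
    abs_of_nonneg (by positivity)]

lemma altSeries_eq (h : IsMinTail a) (m : ℕ) {z : ℝ} (hz : 0 ≤ z) (hz1 : a 1 * z ^ 2 < 1) :
    altSeries a m z = a m - z * altSeries a (m + 1) z := by
  rw [altSeries, (h.summable_alt m hz hz1).tsum_eq_zero_add, altSeries, ← tsum_mul_left,
    sub_eq_add_neg, ← tsum_neg]
  congr 1
  · simp
  · refine tsum_congr fun i => ?_
    rw [show m + (i + 1) = m + 1 + i by ring]
    ring

lemma hasSum_pairs (h : IsMinTail a) (m : ℕ) {z : ℝ} (hz : 0 ≤ z) (hz1 : a 1 * z ^ 2 < 1) :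
    HasSum (fun i => a (m + 2 * i) * z ^ (2 * i) - a (m + 2 * i + 1) * z ^ (2 * i + 1))
      (altSeries a m z) := by
  have hs := h.summable_alt m hz hz1
  have he : Summable fun i => (-1) ^ (2 * i) * a (m + 2 * i) * z ^ (2 * i) :=
    hs.comp_injective (mul_right_injective₀ (two_ne_zero' ℕ))
  have ho : Summable fun i => (-1) ^ (2 * i + 1) * a (m + (2 * i + 1)) * z ^ (2 * i + 1) :=
    hs.comp_injective (i := fun i => 2 * i + 1) fun i j hij => by simpa using hij
  rw [altSeries, ← tsum_even_add_odd (f := fun i => (-1) ^ i * a (m + i) * z ^ i) he ho]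
  refine (he.hasSum.add ho.hasSum).congr_fun fun i => ?_
  rw [pow_succ (-1 : ℝ), pow_mul (-1 : ℝ), ← add_assoc]
  norm_num
  ring

lemma hasSum_geometric (h : IsMinTail a) (m : ℕ) {z : ℝ} (hz1 : a 1 * z ^ 2 < 1) :
    HasSum (fun i => a m * (a 1 * z ^ 2) ^ i) (a m / (1 - a 1 * z ^ 2)) :=
  (hasSum_geometric_of_lt_one (mul_nonneg (h.nonneg 1) (sq_nonneg z)) hz1).mul_left _

lemma term_le (h : IsMinTail a) (m i : ℕ) (z : ℝ) : a (m + 2 * i) * z ^ (2 * i) ≤ a m * (a 1 * z ^ 2) ^ i := by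
  rw [mul_pow, ← pow_mul, ← mul_assoc]
  exact mul_le_mul_of_nonneg_right (h.add_two_mul_le m i) (by rw [pow_mul]; positivity)

lemma altSeries_le (h : IsMinTail a) (m : ℕ) {z : ℝ} (hz : 0 ≤ z) (hz1 : a 1 * z ^ 2 < 1) :
    altSeries a m z ≤ a m / (1 - a 1 * z ^ 2) := by
  refine hasSum_le (fun i => ?_) (h.hasSum_pairs m hz hz1) (h.hasSum_geometric m hz1)
  have := mul_nonneg (h.nonneg (m + 2 * i + 1)) (pow_nonneg hz (2 * i + 1))
  linarith [h.term_le m i z]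

lemma neg_le_altSeries (h : IsMinTail a) (m : ℕ) {z : ℝ} (hz : 0 ≤ z) (hz2 : z ≤ 2) (hz1 : a 1 * z ^ 2 < 1) :
    -(a m / (1 - a 1 * z ^ 2)) ≤ altSeries a m z := by
  refine hasSum_le (fun i => ?_) (h.hasSum_geometric m hz1).neg (h.hasSum_pairs m hz hz1)
  have h1 : a (m + 2 * i + 1) * z ^ (2 * i + 1) ≤ 2 * (a (m + 2 * i) * z ^ (2 * i)) := by
    calc a (m + 2 * i + 1) * z ^ (2 * i + 1) = z * (a (m + 2 * i + 1) * z ^ (2 * i)) := by ring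
      _ ≤ 2 * (a (m + 2 * i) * z ^ (2 * i)) := by
        gcongr
        · exact mul_nonneg (h.nonneg _) (by positivity)
        · exact h.succ_le _
  linarith [h.term_le m i z]

lemma abs_altSeries_le (h : IsMinTail a) (m : ℕ) {z : ℝ} (hz : 0 ≤ z) (hz2 : z ≤ 2) (hz1 : a 1 * z ^ 2 < 1) :
    |altSeries a m z| ≤ a m / (1 - a 1 * z ^ 2) :=
  abs_le.2 ⟨h.neg_le_altSeries m hz hz2 hz1, h.altSeries_le m hz hz1⟩

lemma sub_le_altSeries_one (h : IsMinTail a) (h1 : a 1 < 1) : a 1 - a 2 ≤ altSeries a 1 1 := by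
  have hs := h.hasSum_pairs 1 zero_le_one (by simpa using h1)
  have := sum_le_hasSum {0} (fun i _ => by simpa using h.succ_le _) hs
  simpa using this

lemma continuousOn_altSeries (h : IsMinTail a) (m : ℕ) {Z : ℝ} (hZ : a 1 * Z ^ 2 < 1) :
    ContinuousOn (altSeries a m) (Set.Icc 0 Z) := by
  rcases lt_or_ge Z 0 with hneg | hZ0
  · simp [Set.Icc_eq_empty (not_le.2 hneg)]
  refine continuousOn_tsum (fun i => by fun_prop) (h.summable_mul_pow m hZ0 hZ) fun i z hz => ?_
  rw [Real.norm_eq_abs, abs_mul, abs_mul, abs_pow, abs_neg, abs_one, one_pow, one_mul,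
    abs_of_nonneg (h.nonneg _), abs_of_nonneg (pow_nonneg hz.1 _)]
  exact mul_le_mul_of_nonneg_left (pow_le_pow_left₀ hz.1 hz.2 _) (h.nonneg _)

/-- The function `z ↦ 1 - z + z² ∑ (-1)^i a_{i+1} z^i` is strictly decreasing where
`2 a₁ z < (1 - a₁ z²)²`. -/
lemma sq_mul_altSeries_sub_lt (h : IsMinTail a) {z w Z : ℝ} (hz : 0 ≤ z) (hzw : z < w) (hwZ : w < Z)
    (hZ : a 1 * Z ^ 2 < 1) (hZ2 : 2 * a 1 * Z < (1 - a 1 * Z ^ 2) ^ 2) (h1 : 0 < a 1) :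
    w ^ 2 * altSeries a 1 w - z ^ 2 * altSeries a 1 z < w - z := by
  have hw : 0 ≤ w := hz.trans hzw.le
  have hsq : a 1 * z ^ 2 ≤ a 1 * w ^ 2 :=
    mul_le_mul_of_nonneg_left (pow_le_pow_left₀ hz hzw.le 2) h1.le
  have hsq' : a 1 * w ^ 2 ≤ a 1 * Z ^ 2 :=
    mul_le_mul_of_nonneg_left (pow_le_pow_left₀ hw hwZ.le 2) h1.le
  have hz1 : a 1 * z ^ 2 < 1 := by linarith
  have hw1 : a 1 * w ^ 2 < 1 := by linarith
  have hd := ((h.hasSum_pairs 1 hw hw1).mul_left (w ^ 2)).sub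
    ((h.hasSum_pairs 1 hz hz1).mul_left (z ^ 2))
  have hg := ((h.hasSum_geometric 1 hw1).mul_left (w ^ 2)).sub
    ((h.hasSum_geometric 1 hz1).mul_left (z ^ 2))
  have hle : w ^ 2 * altSeries a 1 w - z ^ 2 * altSeries a 1 z ≤
      w ^ 2 * (a 1 / (1 - a 1 * w ^ 2)) - z ^ 2 * (a 1 / (1 - a 1 * z ^ 2)) := by
    refine hasSum_le (fun i => ?_) hd hg
    have e1 : z ^ (2 * i + 2) ≤ w ^ (2 * i + 2) := pow_le_pow_left₀ hz hzw.le _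
    have e2 : z ^ (2 * i + 3) ≤ w ^ (2 * i + 3) := pow_le_pow_left₀ hz hzw.le _
    have e3 := mul_le_mul_of_nonneg_right (h.add_two_mul_le 1 i) (sub_nonneg.2 e1)
    have e4 := mul_nonneg (h.nonneg (1 + 2 * i + 1)) (sub_nonneg.2 e2)
    simp only [mul_pow, ← pow_mul]
    ring_nf at e3 e4 ⊢
    linarith
  have hzd : 0 < 1 - a 1 * z ^ 2 := by linarith
  have hwd : 0 < 1 - a 1 * w ^ 2 := by linarith
  have hZd : 0 < 1 - a 1 * Z ^ 2 := by linarith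
  refine hle.trans_lt ?_
  have e : w ^ 2 * (a 1 / (1 - a 1 * w ^ 2)) - z ^ 2 * (a 1 / (1 - a 1 * z ^ 2)) =
      a 1 * (w + z) * (w - z) / ((1 - a 1 * w ^ 2) * (1 - a 1 * z ^ 2)) := by
    have := hzd.ne'
    have := hwd.ne'
    rw [← mul_div_assoc, ← mul_div_assoc, div_sub_div _ _ hwd.ne' hzd.ne']
    congr 1
    ring
  rw [e, div_lt_iff₀ (mul_pos hwd hzd), mul_comm (w - z)]
  refine mul_lt_mul_of_pos_right ?_ (sub_pos.2 hzw)
  calc a 1 * (w + z) < 2 * a 1 * Z := by nlinarith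
    _ < (1 - a 1 * Z ^ 2) ^ 2 := hZ2
    _ ≤ (1 - a 1 * w ^ 2) * (1 - a 1 * z ^ 2) := by
      rw [sq]; exact mul_le_mul (by linarith) (by linarith) hZd.le hwd.le

end IsMinTail

section

variable {Ω : Type*} [MeasurableSpace Ω] {μ : Measure Ω} {X : ℕ → Ω → ℝ} {x : ℝ}

lemma C_eq (z : ℝ) : C μ X x z = 1 - z * altSeries (p μ X x) 0 z := by
  rw [C, altSeries, ← tsum_mul_left, sub_eq_add_neg, ← tsum_neg]
  congr 1
  refine tsum_congr fun i => ?_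
  rw [zero_add]
  ring

lemma C_eq_of_isMinTail (h : IsMinTail (p μ X x)) {z : ℝ} (hz : 0 ≤ z)
    (hz1 : p μ X x 1 * z ^ 2 < 1) : C μ X x z = 1 - z + z ^ 2 * altSeries (p μ X x) 1 z := by
  rw [C_eq, h.altSeries_eq 0 hz hz1, h.zero]
  ring

lemma isMinTail_p [IsProbabilityMeasure μ] (hmeas : ∀ i, Measurable (X i))
    (hstat : IsStrictlyStationary μ X) (hdep : IsOneDependent μ X) : IsMinTail (p μ X x) :=
  ⟨p_zero, p_nonneg, p_succ_le, p_add_two_le hmeas hstat hdep⟩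

/-- `C` vanishes somewhere in `(1, 1 + m p₁)` as soon as `m > Z² / (1 - p₁ Z²)` for `Z = 1 + m p₁`. -/
lemma exists_C_eq_zero (h : IsMinTail (p μ X x)) (hp : 0 < p μ X x 1) (hp1 : p μ X x 1 < 1)
    (hp2 : p μ X x 2 < p μ X x 1) {m : ℝ} (hm : 0 < m)
    (hZ : p μ X x 1 * (1 + m * p μ X x 1) ^ 2 < 1)
    (hmZ : (1 + m * p μ X x 1) ^ 2 < m * (1 - p μ X x 1 * (1 + m * p μ X x 1) ^ 2)) :
    ∃ lam ∈ Set.Ioo 1 (1 + m * p μ X x 1), C μ X x lam = 0 := by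
  set a := p μ X x
  set Z := 1 + m * a 1 with hZdef
  have hZ1 : 1 < Z := by have := mul_pos hm hp; linarith
  have hcont : ContinuousOn (C μ X x) (Set.Icc 1 Z) := by
    have e : C μ X x = fun z => 1 - z * altSeries a 0 z := funext C_eq
    rw [e]
    have := (h.continuousOn_altSeries 0 hZ).mono (Set.Icc_subset_Icc_left zero_le_one)
    fun_prop
  have h1 : 0 < C μ X x 1 := by
    rw [C_eq_of_isMinTail h zero_le_one (by simpa using hp1)]
    have := h.sub_le_altSeries_one hp1
    linarith
  have h2 : C μ X x Z < 0 := by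
    rw [C_eq_of_isMinTail h (by linarith) hZ]
    have hd : 0 < 1 - a 1 * Z ^ 2 := by linarith
    have := h.altSeries_le 1 (by linarith : 0 ≤ Z) hZ
    have h3 : Z ^ 2 * altSeries a 1 Z ≤ Z ^ 2 * (a 1 / (1 - a 1 * Z ^ 2)) := by gcongr
    have h4 : Z ^ 2 * (a 1 / (1 - a 1 * Z ^ 2)) < m * a 1 := by
      rw [← mul_div_assoc, div_lt_iff₀ hd]
      nlinarith
    linarith
  obtain ⟨z, hz, hz0⟩ := intermediate_value_Ioo' hZ1.le hcont ⟨h2, h1⟩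
  exact ⟨z, hz, hz0⟩

lemma C_zero_unique (h : IsMinTail (p μ X x)) (hp : 0 < p μ X x 1) {Z : ℝ}
    (hZ : p μ X x 1 * Z ^ 2 < 1) (hZ2 : 2 * p μ X x 1 * Z < (1 - p μ X x 1 * Z ^ 2) ^ 2)
    {z w : ℝ} (hz : z ∈ Set.Ioo 1 Z) (hw : w ∈ Set.Ioo 1 Z) (hz0 : C μ X x z = 0)
    (hw0 : C μ X x w = 0) : z = w := by
  wlog hzw : z < w generalizing z w
  · rcases (not_lt.1 hzw).eq_or_lt with e | e
    · exact e.symm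
    · exact (this hw hz hw0 hz0 e).symm
  exfalso
  have hlt {y : ℝ} (hy : y ∈ Set.Ioo 1 Z) : p μ X x 1 * y ^ 2 < 1 := by
    refine (mul_le_mul_of_nonneg_left ?_ hp.le).trans_lt hZ
    exact pow_le_pow_left₀ (by linarith [hy.1]) hy.2.le 2
  have h0 : 0 ≤ z := by linarith [hz.1]
  rw [C_eq_of_isMinTail h h0 (hlt hz)] at hz0
  rw [C_eq_of_isMinTail h (h0.trans hzw.le) (hlt hw)] at hw0
  have := h.sq_mul_altSeries_sub_lt h0 hzw hw.2 hZ hZ2 hp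
  linarith

end

/-- The sequence `1, q 0, q 1, …`. -/
def consOne (q : ℕ → ℝ) : ℕ → ℝ
  | 0 => 1
  | n + 1 => q n

lemma consOne_zero (q : ℕ → ℝ) : consOne q 0 = 1 := rfl

lemma consOne_succ (q : ℕ → ℝ) (n : ℕ) : consOne q (n + 1) = q n := rfl

/-- The increments of the sequence `n ↦ d n * r ^ n`. -/
def scaledIncrement (d : ℕ → ℝ) (r : ℝ) : ℕ → ℝ
  | 0 => d 0
  | n + 1 => d (n + 1) * r ^ (n + 1) - d n * r ^ n

lemma sum_scaledIncrement (d : ℕ → ℝ) (r : ℝ) (m n : ℕ) :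
    d (m + n) * r ^ (m + n) - d m * r ^ m =
      ∑ k ∈ Finset.range n, scaledIncrement d r (m + k + 1) := by
  induction n with
  | zero => simp
  | succ n ih => rw [Finset.sum_range_succ, ← ih, scaledIncrement, ← add_assoc]; ring

open PowerSeries in
lemma one_sub_X_mul_mk (d : ℕ → ℝ) (r : ℝ) :
    (1 - X) * mk (fun n => d n * r ^ n) = mk (scaledIncrement d r) := by
  ext n
  rcases n with _ | n
  · simp [scaledIncrement, sub_mul]
  · simp [scaledIncrement, sub_mul, coeff_succ_X_mul]

section

variable {a q : ℕ → ℝ} {r : ℝ}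

open PowerSeries in
lemma mk_consOne_mul (hq : ∀ n, q n = (-1) ^ n * a n +
      ∑ j ∈ Finset.range n, (-1) ^ j * (a j * q (n - 1 - j))) :
    mk (fun n => (consOne fun j => -((-1) ^ j * a j)) n * r ^ n) *
      mk (fun n => consOne q n * r ^ n) = 1 := by
  ext n
  rw [coeff_mul, Finset.Nat.sum_antidiagonal_eq_sum_range_succ_mk]
  simp only [coeff_mk, coeff_one]
  rcases n with _ | n
  · simp [consOne_zero]
  · rw [Finset.sum_range_succ', Finset.sum_range_succ]
    simp only [Nat.sub_self, Nat.sub_zero, consOne_zero, consOne_succ, if_neg (Nat.succ_ne_zero n)]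
    have e : ∑ k ∈ Finset.range n, -((-1) ^ k * a k) * r ^ (k + 1) *
        (consOne q (n + 1 - (k + 1)) * r ^ (n + 1 - (k + 1))) =
        -(r ^ (n + 1) * ∑ j ∈ Finset.range n, (-1) ^ j * (a j * q (n - 1 - j))) := by
      rw [Finset.mul_sum, ← Finset.sum_neg_distrib]
      refine Finset.sum_congr rfl fun k hk => ?_
      have hk := Finset.mem_range.1 hk
      rw [show n + 1 - (k + 1) = (n - 1 - k) + 1 by omega, consOne_succ,
        show n + 1 = (k + 1) + (n - 1 - k + 1) by omega, pow_add r (k + 1)]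
      ring
    rw [e, hq n]
    ring

/-- If `1 - r ∑ (-1)^i a_i r^i = 0`, dividing the series by `1 - X` gives its tails. -/
lemma IsMinTail.scaledIncrement_eq (h : IsMinTail a) (hr : 0 ≤ r) (hr1 : a 1 * r ^ 2 < 1)
    (hzero : 1 - r * altSeries a 0 r = 0) (n : ℕ) :
    (consOne fun j => -((-1) ^ j * a j)) n * r ^ n =
      scaledIncrement (fun k => (-1) ^ k * r * altSeries a k r) r n := by
  rcases n with _ | n
  · simp only [consOne, scaledIncrement]
    linear_combination hzero
  · simp only [consOne, scaledIncrement]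
    rw [h.altSeries_eq n hr hr1]
    ring

open PowerSeries in
lemma IsMinTail.mk_mul_mk_eq_one (h : IsMinTail a) (hr : 0 ≤ r) (hr1 : a 1 * r ^ 2 < 1)
    (hzero : 1 - r * altSeries a 0 r = 0) (hq : ∀ n, q n = (-1) ^ n * a n +
      ∑ j ∈ Finset.range n, (-1) ^ j * (a j * q (n - 1 - j))) :
    PowerSeries.mk (fun n => (-1) ^ n * r * altSeries a n r * r ^ n) *
      PowerSeries.mk (scaledIncrement (consOne q) r) =
      1 := by
  rw [← mk_consOne_mul (r := r) hq, funext (h.scaledIncrement_eq hr hr1 hzero),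
    ← one_sub_X_mul_mk]
  have := one_sub_X_mul_mk (fun k => (-1) ^ k * r * altSeries a k r) r
  rw [← this]
  ring

lemma IsMinTail.abs_scaledIncrement_le (h : IsMinTail a) (hr : 0 ≤ r) (hr2 : r ≤ 2)
    (hr1 : a 1 * r ^ 2 < 1) (hzero : 1 - r * altSeries a 0 r = 0)
    (hq : ∀ n, q n = (-1) ^ n * a n +
      ∑ j ∈ Finset.range n, (-1) ^ j * (a j * q (n - 1 - j))) (n : ℕ) :
    |scaledIncrement (consOne q) r (n + 1)| ≤ ∑ j ∈ Finset.range (n + 1),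
      a (j + 1) * r ^ (j + 2) / (1 - a 1 * r ^ 2) *
        |scaledIncrement (consOne q) r (n - j)| := by
  have hc := congrArg (PowerSeries.coeff (n + 1)) (h.mk_mul_mk_eq_one hr hr1 hzero hq)
  rw [PowerSeries.coeff_mul, Finset.Nat.sum_antidiagonal_eq_sum_range_succ_mk,
    Finset.sum_range_succ'] at hc
  simp only [PowerSeries.coeff_mk, PowerSeries.coeff_one, if_neg (Nat.succ_ne_zero n),
    Nat.sub_zero, Nat.add_sub_add_right] at hc
  have e : scaledIncrement (consOne q) r (n + 1) = -∑ k ∈ Finset.range (n + 1),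
      (-1) ^ (k + 1) * r * altSeries a (k + 1) r * r ^ (k + 1) *
        scaledIncrement (consOne q) r (n - k) := by
    linear_combination hc + scaledIncrement (consOne q) r (n + 1) * hzero
  rw [e, abs_neg]
  refine (Finset.abs_sum_le_sum_abs _ _).trans (Finset.sum_le_sum fun j _ => ?_)
  rw [abs_mul]
  refine mul_le_mul_of_nonneg_right ?_ (abs_nonneg _)
  rw [abs_mul, abs_mul, abs_mul, abs_pow, abs_neg, abs_one, one_pow, one_mul, abs_of_nonneg hr,
    abs_of_nonneg (pow_nonneg hr _)]
  calc r * |altSeries a (j + 1) r| * r ^ (j + 1) = r ^ (j + 2) * |altSeries a (j + 1) r| := by ring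
    _ ≤ r ^ (j + 2) * (a (j + 1) / (1 - a 1 * r ^ 2)) :=
      mul_le_mul_of_nonneg_left (h.abs_altSeries_le _ hr hr2 hr1) (pow_nonneg hr _)
    _ = _ := by ring

end

section Majorant

variable {g v : ℕ → ℝ} {θ : ℝ}

/-- The right-hand side of the convolution inequality `|v (n + 1)| ≤ ∑ g j |v (n - j)|`. -/
def convBound (g v : ℕ → ℝ) (n : ℕ) : ℝ := ∑ j ∈ Finset.range (n + 1), g j * |v (n - j)|

lemma convBound_add_two_le (hg : ∀ n, 0 ≤ g n) (hθ : ∀ n, g (n + 2) ≤ θ * g n)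
    (hv : ∀ n, |v (n + 1)| ≤ convBound g v n) (n : ℕ) :
    convBound g v (n + 2) ≤ g 0 * convBound g v (n + 1) + (g 1 + θ) * convBound g v n := by
  have h1 : convBound g v (n + 2) = ∑ j ∈ Finset.range (n + 1), g (j + 2) * |v (n - j)| +
      g 1 * |v (n + 1)| + g 0 * |v (n + 2)| := by
    rw [convBound, Finset.sum_range_succ', Finset.sum_range_succ']
    simp only [Nat.add_sub_add_right, Nat.sub_zero, add_assoc, Nat.reduceAdd,
      show n + 2 - (0 + 1) = n + 1 by omega, zero_add]
  have h2 : ∑ j ∈ Finset.range (n + 1), g (j + 2) * |v (n - j)| ≤ θ * convBound g v n := by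
    rw [convBound, Finset.mul_sum]
    refine Finset.sum_le_sum fun j _ => ?_
    rw [← mul_assoc]
    exact mul_le_mul_of_nonneg_right (hθ j) (abs_nonneg _)
  rw [h1]
  linarith [mul_le_mul_of_nonneg_left (hv n) (hg 1), mul_le_mul_of_nonneg_left (hv (n + 1)) (hg 0)]

lemma sum_mul_le_of_two_step {e : ℕ → ℝ} {β γ : ℝ}
    (he : ∀ n, e (n + 2) ≤ β * e (n + 1) + γ * e n) (n : ℕ) :
    (∑ k ∈ Finset.range n, e (k + 2)) * (1 - β - γ) ≤
      β * e 1 + γ * (e 0 + e 1) - (β + γ) * e (n + 1) - γ * e n := by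
  induction n with
  | zero => simp; linarith
  | succ n ih =>
    rw [Finset.sum_range_succ, add_mul]
    linarith [he n]

end Majorant

section Parameters

variable {α t₂ l η : ℝ}

lemma IsSecondRoot.one_lt_and (hα : 0 < α) (h : IsSecondRoot α t₂) :
    1 < t₂ ∧ 3 * α * t₂ ^ 2 < 1 := by
  obtain ⟨h2, t₁, t₃, h12, h23, h1, h3⟩ := h
  have e12 : α * (t₁ ^ 2 + t₁ * t₂ + t₂ ^ 2) = 1 := by
    refine mul_left_cancel₀ (sub_ne_zero.2 h12.ne') ?_
    linear_combination h2 - h1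
  have e23 : α * (t₂ ^ 2 + t₂ * t₃ + t₃ ^ 2) = 1 := by
    refine mul_left_cancel₀ (sub_ne_zero.2 h23.ne') ?_
    linear_combination h3 - h2
  have hsum : t₁ + t₂ + t₃ = 0 := by
    have h13 : α * (t₃ - t₁) ≠ 0 := mul_ne_zero hα.ne' (sub_ne_zero.2 (h12.trans h23).ne')
    refine mul_left_cancel₀ h13 ?_
    linear_combination e23 - e12
  have ht1 : t₁ = -t₂ - t₃ := by linarith
  subst ht1
  have hprod : α * (t₂ * t₃ * (t₂ + t₃)) = 1 := by linear_combination h2 + t₂ * e23 - 2 * h2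
  have h3pos : 0 < t₃ := by linarith
  have h2pos : 0 < t₂ := by
    by_contra hneg
    have : t₂ * t₃ * (t₂ + t₃) ≤ 0 :=
      mul_nonpos_of_nonpos_of_nonneg (mul_nonpos_of_nonpos_of_nonneg (not_lt.1 hneg) h3pos.le)
        (by linarith)
    have := mul_nonpos_of_nonneg_of_nonpos hα.le this
    linarith
  constructor
  · have := mul_pos hα (pow_pos h2pos 3)
    linarith
  · rw [← e23, mul_comm 3 α, mul_assoc]
    exact mul_lt_mul_of_pos_left (by nlinarith) hα

lemma mul_sq_lt_of_bracket_pos (hα : 0 < α) (hα1 : α ≤ 0.1) (hη : 1 < η)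
    (h : 0 < bracket α η) : α * η ^ 2 < 1 / 5 := by
  rw [bracket] at h
  norm_num at hα1
  set s := α * η ^ 2 with hs
  have hs0 : 0 < s := by positivity
  have hv : (8 / 10) * η ≤ 1 + η - 2 * α * η - 1 := by nlinarith
  have h1 : (1 + (8 / 10) * η) ^ 2 ≤ (1 + η - 2 * α * η) ^ 2 :=
    pow_le_pow_left₀ (by positivity) (by linarith) 2
  have h2 : s * (1 + (8 / 10) * η) ^ 2 ≤ s * (1 + η - 2 * α * η) ^ 2 :=
    mul_le_mul_of_nonneg_left h1 hs0.le
  have h3 : s * 3.24 ≤ s * (1 + (8 / 10) * η) ^ 2 :=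
    mul_le_mul_of_nonneg_left (by nlinarith) hs0.le
  have h4 : 6.4 * s ^ 2 ≤ s * (1 + (8 / 10) * η) ^ 2 := by
    have : 10 * s ≤ η ^ 2 := by rw [hs]; nlinarith [sq_nonneg η]
    nlinarith
  by_contra hge
  rw [not_lt] at hge
  rcases le_or_gt s 1 with hs1 | hs1 <;> nlinarith

lemma two_mul_lt_of_bracket_pos (hα : 0 < α) (hα1 : α ≤ 0.1) (hη : 1 < η)
    (h : 0 < bracket α η) : 2 * α * η < (1 - α * η ^ 2) ^ 2 := by
  have h5 := mul_sq_lt_of_bracket_pos hα hα1 hη h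
  norm_num at hα1
  rw [bracket] at h
  have hs0 : 0 < α * η ^ 2 := by positivity
  have hv : 18 / 10 ≤ 1 + η - 2 * α * η := by nlinarith
  have h3 : α * η ^ 2 * (18 / 10) ^ 2 ≤ α * η ^ 2 * (1 + η - 2 * α * η) ^ 2 :=
    mul_le_mul_of_nonneg_left (pow_le_pow_left₀ (by norm_num) hv 2) hs0.le
  have : α * η ≤ α * η ^ 2 := mul_le_mul_of_nonneg_left (by nlinarith) hα.le
  nlinarith

lemma sq_lt_mul_of_bracket_pos (hα : 0 < α) (hα1 : α ≤ 0.1) (ht : IsSecondRoot α t₂)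
    (hl : t₂ ^ 3 < l) (h : 0 < bracket α (1 + l * α)) :
    (1 + l * α) ^ 2 < l * (1 - α * (1 + l * α) ^ 2) := by
  obtain ⟨ht1, ht3⟩ := ht.one_lt_and hα
  have hη : t₂ < 1 + l * α := by
    have := mul_lt_mul_of_pos_right hl hα
    linarith [ht.1]
  have h5 := mul_sq_lt_of_bracket_pos hα hα1 (ht1.trans hη) h
  set η := 1 + l * α with hηdef
  have hneg : α * η ^ 3 - η + 1 < 0 := by
    have h6 : α * (η ^ 2 + η * t₂ + t₂ ^ 2) < 1 := by nlinarith [mul_pos hα (sub_pos.2 hη)]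
    have := mul_neg_of_pos_of_neg (sub_pos.2 hη) (sub_neg.2 h6)
    linarith [ht.1]
  refine lt_of_mul_lt_mul_left ?_ hα.le
  have : α * (l * (1 - α * η ^ 2)) = (η - 1) * (1 - α * η ^ 2) := by rw [hηdef]; ring
  rw [this]
  nlinarith

lemma fifteen_le_K (hα : 0 < α) (hα1 : α ≤ 0.1) (hl : 1 < l)
    (h : 0 < bracket α (1 + l * α)) : 15 ≤ K α l := by
  have hη : 1 < 1 + l * α := by have := mul_pos (zero_lt_one.trans hl) hα; linarith
  have h5 := mul_sq_lt_of_bracket_pos hα hα1 hη h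
  have h2 := two_mul_lt_of_bracket_pos hα hα1 hη h
  norm_num at hα1
  have hD1 : 1 - α * (1 + l * α) ^ 2 ≤ 1 := by
    have : 0 ≤ α * (1 + l * α) ^ 2 := by positivity
    linarith
  have hN : 2 * (1 - α * (1 + l * α) ^ 2) ≤
      2 + 3 * l * α - α * (2 - l * α) * (1 + l * α) ^ 2 := by
    have : 0 ≤ 3 * (l * α) + l * α * (α * (1 + l * α) ^ 2) := by positivity
    nlinarith
  rw [K]
  set D := 1 - α * (1 + l * α) ^ 2 with hD
  have hD0 : 0 < D := by linarith
  have hfirst : 11 ≤ (11 - 3 * α) / (1 - α) ^ 2 := by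
    rw [le_div_iff₀ (by nlinarith)]
    nlinarith
  have hratio : 2 ≤ (2 + 3 * l * α - α * (2 - l * α) * (1 + l * α) ^ 2) / D ^ 3 := by
    rw [le_div_iff₀ (by positivity)]
    have : D ^ 3 ≤ D := by
      have := pow_le_one₀ hD0.le hD1 (n := 2)
      nlinarith
    linarith
  have hsecond : 4 ≤ 2 * l * (1 + 3 * α) *
      ((2 + 3 * l * α - α * (2 - l * α) * (1 + l * α) ^ 2) / D ^ 3) := by
    have : 2 ≤ 2 * l * (1 + 3 * α) := by nlinarith
    nlinarith
  have hden0 : 0 < 1 - 2 * α * (1 + l * α) / D ^ 2 := by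
    rw [sub_pos, div_lt_one (by positivity)]
    exact h2
  have hden1 : 1 - 2 * α * (1 + l * α) / D ^ 2 ≤ 1 := by
    have : 0 ≤ 2 * α * (1 + l * α) / D ^ 2 := by positivity
    linarith
  rw [le_div_iff₀ hden0]
  linarith

lemma hundred_le_L (hα : 0 < α) (hK : 15 ≤ K α l) : 100 ≤ L α l := by
  rw [L]
  have h1 : 1 ≤ 1 + α + 3 * α ^ 2 := by nlinarith [sq_nonneg α]
  have h2 : 1 ≤ 1 + α + 3 * α ^ 2 + K α l * α ^ 3 := by
    have : 0 ≤ K α l * α ^ 3 := mul_nonneg (by linarith) (by positivity)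
    linarith
  have h3 : 45 ≤ 3 * K α l * (1 + α + 3 * α ^ 2) := by nlinarith
  have h4 : 45 ≤ 3 * K α l * (1 + α + 3 * α ^ 2) * (1 + α + 3 * α ^ 2 + K α l * α ^ 3) := by
    nlinarith
  have h5 : 0 ≤ α ^ 6 * K α l ^ 3 := mul_nonneg (by positivity) (pow_nonneg (by linarith) 3)
  have h6 : 0 ≤ 9 * α * (4 + 3 * α + 3 * α ^ 2) := by positivity
  linarith

lemma twelve_le_E (hα : 0 < α) (hα1 : α ≤ 0.1) (hη : 1 < η) (h : 0 < bracket α η) :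
    12 ≤ E α η := by
  have h5 := mul_sq_lt_of_bracket_pos hα hα1 hη h
  norm_num at hα1
  have hs : 0 < α * η ^ 2 := by positivity
  have hD0 : 0 < 1 - α * η ^ 2 := by linarith
  have hb1 : bracket α η ≤ 1 := by
    have := mul_nonneg hs.le (sq_nonneg (1 + η - 2 * α * η))
    have := pow_le_one₀ hD0.le (by linarith) (n := 2)
    rw [bracket]
    linarith
  have hden : 2 * (1 - α * η ^ 2) ^ 4 * bracket α η ≤ 2 := by
    have := mul_le_one₀ (pow_le_one₀ hD0.le (by linarith) (n := 4)) h.le hb1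
    linarith
  have h1 : 1 ≤ η ^ 5 := one_le_pow₀ hη.le
  have h2 : (18 / 10) ^ 4 ≤ (1 + (1 - 2 * α) * η) ^ 4 :=
    pow_le_pow_left₀ (by norm_num) (by nlinarith) 4
  have h3 : 9 / 10 ≤ 1 + α * (η - 2) := by nlinarith
  have h4 : 27 / 10 ≤ 1 + η + (1 - 3 * α) * η ^ 2 := by nlinarith
  have hnum : 1 * (18 / 10) ^ 4 * (9 / 10) * (27 / 10) ≤ η ^ 5 * (1 + (1 - 2 * α) * η) ^ 4 *
      (1 + α * (η - 2)) * (1 + η + (1 - 3 * α) * η ^ 2) := by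
    gcongr
  rw [E]
  have : 12 ≤ η ^ 5 * (1 + (1 - 2 * α) * η) ^ 4 * (1 + α * (η - 2)) *
      (1 + η + (1 - 3 * α) * η ^ 2) / (2 * (1 - α * η ^ 2) ^ 4 * bracket α η) := by
    rw [le_div_iff₀ (by positivity)]
    norm_num at hnum
    linarith
  norm_num
  linarith

lemma le_Gam (hα : 0 < α) (hα1 : α ≤ 0.1) (hl : 1 < l) (h : 0 < bracket α (1 + l * α)) :
    112 ≤ Gam α l := by
  have hη : 1 < 1 + l * α := by have := mul_pos (zero_lt_one.trans hl) hα; linarith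
  have := hundred_le_L hα (fifteen_le_K hα hα1 hl h)
  have := twelve_le_E hα hα1 hη h
  rw [Gam]
  linarith

end Parameters

section Expansion

/-- Third-order expansion of `q₃ λ³`, with `λ = 1 + p w`, `p₁ = p`, `p₂ = b p`, `p₃ = c p²`,
`p₄ = d p²`. -/
lemma q_three_expansion {p b c d w ρ k : ℝ} (hk : w = 1 - b + p * k)
    (hk' : k = c - d + (2 - 3 * b) * w + p * (1 - 3 * b) * w ^ 2 - p ^ 2 * b * w ^ 3 +
      p * (w * (c * (4 + 6 * (p * w) + 4 * (p * w) ^ 2 + (p * w) ^ 3) -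
        d * (5 + 10 * (p * w) + 10 * (p * w) ^ 2 + 5 * (p * w) ^ 3 + (p * w) ^ 4))) + p * ρ) :
    (1 - 3 * p + 2 * (b * p) + p ^ 2 - c * p ^ 2) * (1 + p * w) ^ 3 -
      (1 - b * p + 2 * (c * p ^ 2) - 3 * (d * p ^ 2) + p ^ 2 + 6 * (b * p) ^ 2 -
        6 * p * (b * p)) =
    (3 * (w - 2 * b) * k + 3 * ρ - 3 * w ^ 2 * (2 + b - p * (1 - c)) - 3 * (p * b * w ^ 3) +
      3 * (w * (c * (4 + 6 * (p * w) + 4 * (p * w) ^ 2 + (p * w) ^ 3) -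
        d * (5 + 10 * (p * w) + 10 * (p * w) ^ 2 + 5 * (p * w) ^ 3 + (p * w) ^ 4))) +
      w ^ 3 + 3 * (1 - c) * w - p * (3 - 2 * b + p * (c - 1)) * w ^ 3) * p ^ 3 := by
  obtain rfl : b = 1 - w + p * k := by linarith
  linear_combination 3 * p ^ 2 * hk'

lemma mul_le_of_le_of_nonneg {s S t T : ℝ} (hs : 0 ≤ s) (hsS : s ≤ S) (htT : t ≤ T) (hT : 0 ≤ T) :
    s * t ≤ S * T :=
  (mul_le_mul_of_nonneg_left htT hs).trans (mul_le_mul_of_nonneg_right hsS hT)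

lemma neg_mul_le_of_le_of_nonneg {s S t T : ℝ} (hs : 0 ≤ s) (hsS : s ≤ S) (htT : -T ≤ t)
    (hT : 0 ≤ T) : -(S * T) ≤ s * t := by
  have := mul_le_of_le_of_nonneg hs hsS (neg_le.1 htT) hT
  linarith

lemma abs_q_three_mul_sub_le {p b c d w ρ k : ℝ} (hp : 0 < p) (hp1 : p ≤ 1 / 10) (hb : 0 ≤ b)
    (hb1 : b ≤ 55 / 100) (hd : 0 ≤ d) (hdc : d ≤ c) (hc : c ≤ 1) (hw : 0 ≤ w)
    (hw1 : w ≤ 154 / 100) (hρ : |ρ| ≤ 273 / 100) (hk : w = 1 - b + p * k)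
    (hk' : k = c - d + (2 - 3 * b) * w + p * (1 - 3 * b) * w ^ 2 - p ^ 2 * b * w ^ 3 +
      p * (w * (c * (4 + 6 * (p * w) + 4 * (p * w) ^ 2 + (p * w) ^ 3) -
        d * (5 + 10 * (p * w) + 10 * (p * w) ^ 2 + 5 * (p * w) ^ 3 + (p * w) ^ 4))) + p * ρ) :
    |(1 - 3 * p + 2 * (b * p) + p ^ 2 - c * p ^ 2) * (1 + p * w) ^ 3 -
      (1 - b * p + 2 * (c * p ^ 2) - 3 * (d * p ^ 2) + p ^ 2 + 6 * (b * p) ^ 2 -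
        6 * p * (b * p))| ≤ 66 * p ^ 3 := by
  rw [q_three_expansion hk hk', abs_mul, abs_of_pos (pow_pos hp 3)]
  refine mul_le_mul_of_nonneg_right ?_ (by positivity)
  have hy0 : 0 ≤ p * w := by positivity
  have hy1 : p * w ≤ 154 / 1000 :=
    (mul_le_of_le_of_nonneg hp.le hp1 hw1 (by norm_num)).trans (by norm_num)
  obtain ⟨hρ0, hρ1⟩ := abs_le.1 hρ
  have hc0 : 0 ≤ c := hd.trans hdc
  have hw2 : w ^ 2 ≤ (154 / 100) ^ 2 := pow_le_pow_left₀ hw hw1 2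
  have hw3 : w ^ 3 ≤ (154 / 100) ^ 3 := pow_le_pow_left₀ hw hw1 3
  have hw20 : 0 ≤ w ^ 2 := by positivity
  have hw30 : 0 ≤ w ^ 3 := by positivity
  set y := p * w
  have hy2 : y ^ 2 ≤ (154 / 1000) ^ 2 := pow_le_pow_left₀ hy0 hy1 2
  have hy3 : y ^ 3 ≤ (154 / 1000) ^ 3 := pow_le_pow_left₀ hy0 hy1 3
  have hy4 : y ^ 4 ≤ (154 / 1000) ^ 4 := pow_le_pow_left₀ hy0 hy1 4
  have hy20 : 0 ≤ y ^ 2 := by positivity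
  have hy30 : 0 ≤ y ^ 3 := by positivity
  have hy40 : 0 ≤ y ^ 4 := by positivity
  set h4 := 4 + 6 * y + 4 * y ^ 2 + y ^ 3 with hh4
  set h5 := 5 + 10 * y + 10 * y ^ 2 + 5 * y ^ 3 + y ^ 4 with hh5
  have h4lo : 4 ≤ h4 := by linarith
  have h4hi : h4 ≤ 5.0227 := by norm_num at hy2 hy3 ⊢; linarith
  have h54 : h5 - h4 ≤ 1.8 := by norm_num at hy2 hy3 hy4 ⊢; linarith
  have h50 : 0 ≤ h5 := by linarith
  have hT1 : w * (c * h4 - d * h5) + (1 - c) * w ≤ 7.736 := by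
    have e1 : c * h4 - d * h5 + (1 - c) ≤ h4 := by
      have := mul_nonneg hd h50
      have : 0 ≤ (1 - c) * (h4 - 1) := mul_nonneg (by linarith) (by linarith)
      linarith
    have e2 : w * (c * h4 - d * h5 + (1 - c)) ≤ 154 / 100 * 5.0227 := by
      calc w * (c * h4 - d * h5 + (1 - c)) ≤ w * h4 := by gcongr
        _ ≤ _ := by gcongr
    norm_num at e2 ⊢
    linarith
  have hT0 : -2.8 ≤ w * (c * h4 - d * h5) := by
    have e1 : -1.8 ≤ c * h4 - d * h5 := by
      have := mul_le_mul_of_nonneg_right hdc h50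
      have h54' : h5 - h4 ≤ 9 / 5 := by norm_num at h54 ⊢; exact h54
      have := mul_le_of_le_of_nonneg hc0 hc h54' (by norm_num)
      norm_num
      linarith
    refine le_trans ?_ (neg_mul_le_of_le_of_nonneg hw hw1 (neg_le.1 (neg_le.1 e1)) (by norm_num))
    norm_num
  have hcw : 0 ≤ (1 - c) * w := mul_nonneg (by linarith) hw
  set T := w * (c * h4 - d * h5)
  norm_num at hT1 hT0 hw2 hw3
  have hpw {s : ℝ} (hs : s ≤ 1) : p * s * w ^ 2 ≤ 1 / 10 * (5929 / 2500) := by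
    rw [mul_assoc]
    refine mul_le_of_le_of_nonneg hp.le hp1 ?_ (by norm_num)
    calc s * w ^ 2 ≤ 1 * w ^ 2 := mul_le_mul_of_nonneg_right hs hw20
      _ ≤ _ := by rw [one_mul]; exact hw2
  have hpT : p * T ≤ 1 / 10 * (967 / 125) :=
    mul_le_of_le_of_nonneg hp.le hp1 (by linarith) (by norm_num)
  have hpT' : -(1 / 10 * (14 / 5)) ≤ p * T :=
    neg_mul_le_of_le_of_nonneg hp.le hp1 (by linarith) (by norm_num)
  have hpρ : p * ρ ≤ 1 / 10 * (273 / 100) :=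
    mul_le_of_le_of_nonneg hp.le hp1 hρ1 (by norm_num)
  have hpρ' : -(1 / 10 * (273 / 100)) ≤ p * ρ :=
    neg_mul_le_of_le_of_nonneg hp.le hp1 hρ0 (by norm_num)
  have hbw : 0 ≤ b * w := by positivity
  have e3 : 0 ≤ p ^ 2 * b * w ^ 3 := by positivity
  have e3' : p ^ 2 * b * w ^ 3 ≤ 1 := by
    calc p ^ 2 * b * w ^ 3 ≤ (1 / 10) ^ 2 * (55 / 100) * (456533 / 125000) := by gcongr
      _ ≤ 1 := by norm_num
  have hkhi : k ≤ 27 / 5 := by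
    have := hpw (s := 1 - 3 * b) (by linarith)
    linarith
  have hklo : -(27 / 5) ≤ k := by
    have e1 : 0 ≤ (2 - 3 * b) * w := mul_nonneg (by linarith) hw
    have := hpw (s := -(1 - 3 * b)) (by linarith)
    linarith
  have hwk : |3 * (w - 2 * b) * k| ≤ 3 * (154 / 100) * (27 / 5) := by
    rw [abs_mul, abs_mul]
    gcongr
    · norm_num
    · exact abs_le.2 ⟨by linarith, by linarith⟩
    · exact abs_le.2 ⟨hklo, hkhi⟩
  obtain ⟨hwk0, hwk1⟩ := abs_le.1 hwk
  norm_num at hwk0 hwk1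
  have hpc0 : 0 ≤ p * (1 - c) := mul_nonneg hp.le (by linarith)
  have hpc1 : p * (1 - c) ≤ 1 / 10 * 1 :=
    mul_le_of_le_of_nonneg hp.le hp1 (by linarith) zero_le_one
  have f1 : 0 ≤ w ^ 2 * (2 + b - p * (1 - c)) := mul_nonneg hw20 (by linarith)
  have f1' : w ^ 2 * (2 + b - p * (1 - c)) ≤ 5929 / 2500 * (255 / 100) :=
    mul_le_of_le_of_nonneg hw20 hw2 (by linarith) (by norm_num)
  have f2 : 0 ≤ p * b * w ^ 3 := by positivity
  have f2' : p * b * w ^ 3 ≤ 1 := by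
    calc p * b * w ^ 3 ≤ 1 / 10 * (55 / 100) * (456533 / 125000) := by gcongr
      _ ≤ 1 := by norm_num
  have f3a : 0 ≤ 3 - 2 * b + p * (c - 1) := by linarith
  have f3b : 3 - 2 * b + p * (c - 1) ≤ 3 := by linarith
  have f3 : 0 ≤ p * (3 - 2 * b + p * (c - 1)) * w ^ 3 := by positivity
  have f3' : p * (3 - 2 * b + p * (c - 1)) * w ^ 3 ≤ 2 := by
    calc p * (3 - 2 * b + p * (c - 1)) * w ^ 3 ≤ 1 / 10 * 3 * (456533 / 125000) := by gcongr
      _ ≤ 2 := by norm_num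
  rw [abs_le]
  constructor <;> linarith

end Expansion

section Assembly

variable {a q : ℕ → ℝ} {r : ℝ}

lemma sum_abs_scaledIncrement_le (h : IsMinTail a) (hp : 0 < a 1) (hp1 : a 1 ≤ 1 / 10)
    (h2 : a 2 ≤ 55 / 100 * a 1) (hr : 1 ≤ r) (hr1 : r ≤ 1154 / 1000)
    (hzero : 1 - r * altSeries a 0 r = 0)
    (hq : ∀ n, q n = (-1) ^ n * a n + ∑ j ∈ Finset.range n, (-1) ^ j * (a j * q (n - 1 - j)))
    (n : ℕ) :
    ∑ k ∈ Finset.range n, |scaledIncrement (consOne q) r (4 + k + 1)| ≤ 43 * a 1 ^ 3 := by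
  have hr0 : 0 ≤ r := by linarith
  have hr2 : r ^ 2 ≤ 13318 / 10000 := (pow_le_pow_left₀ hr0 hr1 2).trans (by norm_num)
  have hr3 : r ^ 3 ≤ 15369 / 10000 := (pow_le_pow_left₀ hr0 hr1 3).trans (by norm_num)
  have hθ : a 1 * r ^ 2 ≤ 1 / 10 * (13318 / 10000) :=
    mul_le_of_le_of_nonneg hp.le hp1 hr2 (by norm_num)
  have hθ1 : a 1 * r ^ 2 < 1 := hθ.trans_lt (by norm_num)
  have hD : 86682 / 100000 ≤ 1 - a 1 * r ^ 2 := by linarith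
  have hD0 : 0 < 1 - a 1 * r ^ 2 := by linarith
  set v := scaledIncrement (consOne q) r with hv
  set g : ℕ → ℝ := fun j => a (j + 1) * r ^ (j + 2) / (1 - a 1 * r ^ 2) with hg
  have hg0 (j : ℕ) : 0 ≤ g j :=
    div_nonneg (mul_nonneg (h.nonneg _) (pow_nonneg hr0 _)) hD0.le
  have hgθ (j : ℕ) : g (j + 2) ≤ a 1 * r ^ 2 * g j := by
    rw [hg]
    simp only
    rw [← mul_div_assoc]
    refine div_le_div_of_nonneg_right ?_ hD0.le
    calc a (j + 2 + 1) * r ^ (j + 2 + 2) ≤ a 1 * a (j + 1) * r ^ (j + 2 + 2) :=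
          mul_le_mul_of_nonneg_right (h.add_two_le (j + 1)) (pow_nonneg hr0 _)
      _ = _ := by ring
  have hvle (k : ℕ) : |v (k + 1)| ≤ convBound g v k :=
    h.abs_scaledIncrement_le hr0 (by linarith) hθ1 hzero hq k
  have hrec := convBound_add_two_le hg0 hgθ hvle
  have hbound := sum_mul_le_of_two_step (e := fun k => convBound g v (k + 2))
    (fun k => hrec (k + 2)) n
  have hnn (k : ℕ) : 0 ≤ convBound g v k :=
    Finset.sum_nonneg fun j _ => mul_nonneg (hg0 j) (abs_nonneg _)
  have hsum : ∑ k ∈ Finset.range n, |v (4 + k + 1)| ≤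
      ∑ k ∈ Finset.range n, convBound g v (k + 2 + 2) :=
    Finset.sum_le_sum fun k _ => (hvle (4 + k)).trans_eq (by rw [add_comm 4 k])
  refine hsum.trans ?_
  have hv0 : |v 0| = 1 := by simp [hv, scaledIncrement, consOne_zero]
  have hβ : g 0 ≤ 15365 / 10000 * a 1 := by
    simp only [hg]
    rw [div_le_iff₀ hD0]
    have e1 : a (0 + 1) * r ^ (0 + 2) ≤ a 1 * (13318 / 10000) :=
      mul_le_mul_of_nonneg_left hr2 hp.le
    have e2 := mul_le_mul_of_nonneg_left hD (by positivity : 0 ≤ 15365 / 10000 * a 1)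
    linarith
  have hδ : g 1 ≤ 9753 / 10000 * a 1 := by
    simp only [hg]
    rw [div_le_iff₀ hD0]
    have e1 : a (1 + 1) * r ^ (1 + 2) ≤ 55 / 100 * a 1 * (15369 / 10000) :=
      mul_le_of_le_of_nonneg (h.nonneg _) h2 hr3 (by norm_num)
    have e2 := mul_le_mul_of_nonneg_left hD (by positivity : 0 ≤ 9753 / 10000 * a 1)
    linarith
  have hγ : g 1 + a 1 * r ^ 2 ≤ 23071 / 10000 * a 1 := by
    have := mul_le_mul_of_nonneg_left hr2 hp.le
    linarith
  have hγ0 : 0 ≤ g 1 + a 1 * r ^ 2 := add_nonneg (hg0 1) (by positivity)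
  set β := g 0
  set γ := g 1 + a 1 * r ^ 2
  have hpp : a 1 * a 1 ≤ 1 / 10 * a 1 := mul_le_mul_of_nonneg_right hp1 hp.le
  have hppp : a 1 * (a 1 ^ 2) ≤ 1 / 10 * a 1 ^ 2 := mul_le_mul_of_nonneg_right hp1 (by positivity)
  have e0 : convBound g v 0 ≤ 15365 / 10000 * a 1 := by
    simpa [convBound, hv0] using hβ
  have e1 : convBound g v 1 ≤ 12115 / 10000 * a 1 := by
    have : convBound g v 1 = β * |v 1| + g 1 := by
      simp [convBound, Finset.sum_range_succ, hv0, β]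
    have h1 := mul_le_of_le_of_nonneg (hg0 0) hβ ((hvle 0).trans e0) (by positivity)
    rw [this]
    linarith
  have e2 : convBound g v 2 ≤ 5407 / 1000 * a 1 ^ 2 := by
    have h1 := mul_le_of_le_of_nonneg (hg0 0) hβ e1 (by positivity)
    have h2 := mul_le_of_le_of_nonneg hγ0 hγ e0 (by positivity)
    have := hrec 0
    have : 0 ≤ a 1 ^ 2 := by positivity
    linarith
  have e3 : convBound g v 3 ≤ 3627 / 1000 * a 1 ^ 2 := by
    have h1 := mul_le_of_le_of_nonneg (hg0 0) hβ e2 (by positivity)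
    have h2 := mul_le_of_le_of_nonneg hγ0 hγ e1 (by positivity)
    have := hrec 1
    have : 0 ≤ a 1 ^ 2 := by positivity
    linarith
  have h1 := mul_le_of_le_of_nonneg (hg0 0) hβ e3 (by positivity)
  have h2 := mul_le_of_le_of_nonneg hγ0 hγ (add_le_add e2 e3) (by positivity)
  have h3 : 0 ≤ (β + γ) * convBound g v (n + 3) :=
    mul_nonneg (add_nonneg (hg0 0) hγ0) (hnn _)
  have h4 : 0 ≤ γ * convBound g v (n + 2) := mul_nonneg hγ0 (hnn _)
  have h5 : 615 / 1000 ≤ 1 - β - γ := by linarith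
  have h6 := mul_le_mul_of_nonneg_left h5
    (Finset.sum_nonneg fun k (_ : k ∈ Finset.range n) => hnn (k + 2 + 2))
  have h7 : 0 < a 1 ^ 3 := by positivity
  simp only [Nat.reduceAdd, zero_add, Nat.add_assoc] at hbound h6 ⊢
  linarith

lemma abs_q_mul_pow_sub_q_three_le (h : IsMinTail a) (hp : 0 < a 1) (hp1 : a 1 ≤ 1 / 10)
    (h2 : a 2 ≤ 55 / 100 * a 1) (hr : 1 ≤ r) (hr1 : r ≤ 1154 / 1000)
    (hzero : 1 - r * altSeries a 0 r = 0)
    (hq : ∀ n, q n = (-1) ^ n * a n + ∑ j ∈ Finset.range n, (-1) ^ j * (a j * q (n - 1 - j)))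
    {n : ℕ} (hn : 3 ≤ n) : |q n * r ^ n - q 3 * r ^ 3| ≤ 43 * a 1 ^ 3 := by
  obtain ⟨m, rfl⟩ := Nat.exists_eq_add_of_le hn
  have hsum := sum_scaledIncrement (consOne q) r 4 m
  have hle := (Finset.abs_sum_le_sum_abs _ _).trans
    (sum_abs_scaledIncrement_le h hp hp1 h2 hr hr1 hzero hq m)
  rw [← hsum, show 4 + m = 3 + m + 1 by ring, consOne_succ, consOne_succ,
    show q (3 + m) * r ^ (3 + m + 1) - q 3 * r ^ 4 = r * (q (3 + m) * r ^ (3 + m) - q 3 * r ^ 3)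
      by ring, abs_mul, abs_of_pos (by linarith)] at hle
  exact (le_mul_of_one_le_left (abs_nonneg _) hr).trans hle

lemma q_three_eq (ha : a 0 = 1) (hq : ∀ n, q n = (-1) ^ n * a n +
      ∑ j ∈ Finset.range n, (-1) ^ j * (a j * q (n - 1 - j))) :
    q 3 = 1 - 3 * a 1 + 2 * a 2 + a 1 ^ 2 - a 3 := by
  have h0 : q 0 = 1 := by rw [hq]; simp [ha]
  have h1 : q 1 = 1 - a 1 := by rw [hq]; simp [ha, h0]; ring
  have h2 : q 2 = 1 - 2 * a 1 + a 2 := by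
    rw [hq]; simp [Finset.sum_range_succ, ha, h0, h1]; ring
  rw [hq]
  simp [Finset.sum_range_succ, ha, h0, h1, h2]
  ring

lemma IsMinTail.expand_five (h : IsMinTail a) (hr : 0 ≤ r) (hr1 : a 1 * r ^ 2 < 1)
    (hzero : 1 - r * altSeries a 0 r = 0) :
    1 - r + a 1 * r ^ 2 - a 2 * r ^ 3 + a 3 * r ^ 4 - a 4 * r ^ 5 + r ^ 6 * altSeries a 5 r = 0 := by
  rw [h.altSeries_eq 0 hr hr1, h.altSeries_eq 1 hr hr1, h.altSeries_eq 2 hr hr1,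
    h.altSeries_eq 3 hr hr1, h.altSeries_eq 4 hr hr1, h.zero] at hzero
  linear_combination hzero

lemma abs_q_three_mul_pow_sub_le (h : IsMinTail a) (hp : 0 < a 1) (hp1 : a 1 ≤ 1 / 10)
    (h2 : a 2 ≤ 55 / 100 * a 1) (hr : 1 ≤ r) (hr1 : r ≤ 1 + 154 / 100 * a 1)
    (hzero : 1 - r * altSeries a 0 r = 0)
    (hq : ∀ n, q n = (-1) ^ n * a n + ∑ j ∈ Finset.range n, (-1) ^ j * (a j * q (n - 1 - j))) :
    |q 3 * r ^ 3 - (1 - a 2 + 2 * a 3 - 3 * a 4 + a 1 ^ 2 + 6 * a 2 ^ 2 - 6 * a 1 * a 2)| ≤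
      66 * a 1 ^ 3 := by
  have hr0 : 0 ≤ r := by linarith
  have hrle : r ≤ 1154 / 1000 := by linarith
  have hr2 : r ^ 2 ≤ 13318 / 10000 := (pow_le_pow_left₀ hr0 hrle 2).trans (by norm_num)
  have hr6 : r ^ 6 ≤ 2362 / 1000 := (pow_le_pow_left₀ hr0 hrle 6).trans (by norm_num)
  have hθ : a 1 * r ^ 2 ≤ 1 / 10 * (13318 / 10000) :=
    mul_le_of_le_of_nonneg hp.le hp1 hr2 (by norm_num)
  have hθ1 : a 1 * r ^ 2 < 1 := hθ.trans_lt (by norm_num)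
  have hD0 : 0 < 1 - a 1 * r ^ 2 := by linarith
  have hexp := h.expand_five hr0 hθ1 hzero
  have hT := h.abs_altSeries_le 5 hr0 (by linarith) hθ1
  have h3 : a 3 ≤ a 1 ^ 2 := by simpa [sq] using h.add_two_mul_le 1 1
  have h5 : a 5 ≤ a 1 ^ 3 := (h.add_two_mul_le 1 2).trans_eq (by ring)
  have h4 : a 4 ≤ a 3 := h.succ_le 3
  rw [q_three_eq h.zero hq]
  have hne : a 1 ≠ 0 := hp.ne'
  have hrho : |r ^ 6 * altSeries a 5 r / a 1 ^ 3| ≤ 273 / 100 := by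
    rw [abs_div, abs_mul, abs_of_nonneg (pow_nonneg hr0 6), abs_of_pos (pow_pos hp 3),
      div_le_iff₀ (pow_pos hp 3)]
    have hT' : |altSeries a 5 r| ≤ a 1 ^ 3 * (11537 / 10000) := by
      refine hT.trans ?_
      rw [div_le_iff₀ hD0, mul_assoc]
      refine h5.trans (le_mul_of_one_le_right (by positivity) ?_)
      linarith
    calc r ^ 6 * |altSeries a 5 r| ≤ 2362 / 1000 * (a 1 ^ 3 * (11537 / 10000)) := by gcongr
      _ = 2362 / 1000 * (11537 / 10000) * a 1 ^ 3 := by ring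
      _ ≤ _ := mul_le_mul_of_nonneg_right (by norm_num) (by positivity)
  obtain ⟨b, hb⟩ : ∃ b, a 2 = b * a 1 := ⟨a 2 / a 1, (div_mul_cancel₀ _ hne).symm⟩
  obtain ⟨c, hc⟩ : ∃ c, a 3 = c * a 1 ^ 2 := ⟨a 3 / a 1 ^ 2, by field_simp⟩
  obtain ⟨d, hd⟩ : ∃ d, a 4 = d * a 1 ^ 2 := ⟨a 4 / a 1 ^ 2, by field_simp⟩
  obtain ⟨w, hw⟩ : ∃ w, r = 1 + a 1 * w := ⟨(r - 1) / a 1, by field_simp; ring⟩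
  obtain ⟨ρ, hρ⟩ : ∃ ρ, r ^ 6 * altSeries a 5 r / a 1 ^ 3 = ρ := ⟨_, rfl⟩
  obtain ⟨k, hk⟩ : ∃ k, w = 1 - b + a 1 * k := ⟨(w - 1 + b) / a 1, by field_simp; ring⟩
  have hρ' : r ^ 6 * altSeries a 5 r = ρ * a 1 ^ 3 := by rw [← hρ]; field_simp
  have n2 := h.nonneg 2
  have n4 := h.nonneg 4
  rw [hρ] at hrho
  rw [hρ'] at hexp
  rw [hb, hc, hd, hw] at hexp
  rw [hb] at h2 n2
  rw [hc] at h3 h4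
  rw [hd] at h4 n4
  rw [hb, hc, hd, hw]
  have hsq : 0 < a 1 ^ 2 := by positivity
  refine abs_q_three_mul_sub_le (k := k) (ρ := ρ) hp hp1 (nonneg_of_mul_nonneg_left n2 hp)
    (le_of_mul_le_mul_right h2 hp) (nonneg_of_mul_nonneg_left n4 hsq)
    (le_of_mul_le_mul_right h4 hsq) (le_of_mul_le_mul_right (by linarith) hsq)
    (nonneg_of_mul_nonneg_right (by linarith : 0 ≤ a 1 * w) hp)
    (le_of_mul_le_mul_left (by linarith : a 1 * w ≤ a 1 * (154 / 100)) hp) hrho hk ?_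
  refine mul_left_cancel₀ hsq.ne' ?_
  linear_combination -hexp - a 1 * hk

end Assembly

end OneDependent

theorem theoremT2 {Ω : Type*} [MeasurableSpace Ω] (μ : Measure Ω) [IsProbabilityMeasure μ]
    (X : ℕ → Ω → ℝ) (hmeas : ∀ i, Measurable (X i))
    (hstat : OneDependent.IsStrictlyStationary μ X) (hdep : OneDependent.IsOneDependent μ X)
    (x α t₂ l : ℝ)
    (hp : 0 < OneDependent.p μ X x 1) (hpα : OneDependent.p μ X x 1 ≤ α) (hα : α ≤ 0.1)
    (ht₂ : OneDependent.IsSecondRoot α t₂) (hl : t₂ ^ 3 < l)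
    (hbr : 0 < OneDependent.bracket α (1 + l * α)) :
    ∃ lam : ℝ,
      (lam ∈ Set.Ioo 1 (1 + l * OneDependent.p μ X x 1) ∧ OneDependent.C μ X x lam = 0) ∧
      (∀ z ∈ Set.Ioo 1 (1 + l * OneDependent.p μ X x 1),
        OneDependent.C μ X x z = 0 → z = lam) ∧
      ∀ n : ℕ, 3 ≤ n →
        |OneDependent.q μ X x n * lam ^ n -
            (1 - OneDependent.p μ X x 2 + 2 * OneDependent.p μ X x 3 - 3 * OneDependent.p μ X x 4 +
              OneDependent.p μ X x 1 ^ 2 + 6 * OneDependent.p μ X x 2 ^ 2 -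
              6 * OneDependent.p μ X x 1 * OneDependent.p μ X x 2)| ≤
          OneDependent.Gam α l * OneDependent.p μ X x 1 ^ 3 := by
  open OneDependent in
  have hα0 : 0 < α := hp.trans_le hpα
  have h := isMinTail_p (x := x) hmeas hstat hdep
  have hl1 : 1 < l := (one_lt_pow₀ (ht₂.one_lt_and hα0).1 (by norm_num)).trans hl
  have hη : 1 < 1 + l * α := by have := mul_pos (zero_lt_one.trans hl1) hα0; linarith
  have hηZ : 1 + l * p μ X x 1 ≤ 1 + l * α := by
    have := mul_le_mul_of_nonneg_left hpα (zero_le_one.trans hl1.le)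
    linarith
  have hsqα := mul_sq_lt_of_bracket_pos hα0 hα hη hbr
  have htwo := two_mul_lt_of_bracket_pos hα0 hα hη hbr
  have hlα := sq_lt_mul_of_bracket_pos hα0 hα ht₂ hl hbr
  have hΓ := le_Gam hα0 hα hl1 hbr
  have h22 := two_mul_p_two_le (μ := μ) (x := x) hmeas hstat
  have h3 : p μ X x 3 ≤ p μ X x 1 ^ 2 := by simpa [sq] using h.add_two_mul_le 1 1
  have hp1 : p μ X x 1 ≤ 1 / 10 := by norm_num at hα; linarith
  set a := p μ X x with ha
  have h2 : a 2 ≤ 55 / 100 * a 1 := by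
    have := mul_le_mul_of_nonneg_right hp1 hp.le
    linarith
  have hZ0 : 0 ≤ 1 + l * a 1 := by have := mul_pos (zero_lt_one.trans hl1) hp; linarith
  have hZsq : (1 + l * a 1) ^ 2 ≤ (1 + l * α) ^ 2 := pow_le_pow_left₀ hZ0 hηZ 2
  have hZα : a 1 * (1 + l * a 1) ^ 2 ≤ α * (1 + l * α) ^ 2 :=
    mul_le_mul hpα hZsq (sq_nonneg _) hα0.le
  have hZ1 : a 1 * (1 + l * a 1) ^ 2 < 1 := by linarith
  have hlZ : (1 + l * a 1) ^ 2 < l * (1 - a 1 * (1 + l * a 1) ^ 2) := by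
    have := mul_le_mul_of_nonneg_left hZα (zero_le_one.trans hl1.le)
    linarith
  have hZtwo : 2 * a 1 * (1 + l * a 1) < (1 - a 1 * (1 + l * a 1) ^ 2) ^ 2 := by
    have e1 : 2 * a 1 * (1 + l * a 1) ≤ 2 * α * (1 + l * α) := by gcongr
    have e2 := pow_le_pow_left₀ (by linarith : 0 ≤ 1 - α * (1 + l * α) ^ 2)
      (sub_le_sub_left hZα 1) 2
    linarith
  obtain ⟨lam, ⟨hlam1, hlaml, hlamY⟩, hlam0⟩ : ∃ lam, (1 < lam ∧ lam < 1 + l * a 1 ∧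
      lam ≤ 1 + 154 / 100 * a 1) ∧ C μ X x lam = 0 := by
    have hp2 : a 2 < a 1 := by linarith
    rcases le_or_gt l (154 / 100) with hle | hlt
    · obtain ⟨lam, hlam, h0⟩ := exists_C_eq_zero h hp (by linarith) hp2 (by linarith) hZ1 hlZ
      refine ⟨lam, ⟨hlam.1, hlam.2, hlam.2.le.trans ?_⟩, h0⟩
      gcongr
    · have hY0 : 0 < 1 + 154 / 100 * a 1 := by positivity
      have hY : (1 + 154 / 100 * a 1) ^ 2 ≤ 13318 / 10000 :=
        (pow_le_pow_left₀ hY0.le (by linarith : 1 + 154 / 100 * a 1 ≤ 1154 / 1000) 2).trans (by norm_num)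
      have hYp : a 1 * (1 + 154 / 100 * a 1) ^ 2 ≤ 1 / 10 * (13318 / 10000) :=
        mul_le_of_le_of_nonneg hp.le hp1 hY (by norm_num)
      obtain ⟨lam, hlam, h0⟩ := exists_C_eq_zero h hp (by linarith) hp2
        (m := 154 / 100) (by norm_num) (by linarith) (by linarith)
      refine ⟨lam, ⟨hlam.1, hlam.2.trans_le ?_, hlam.2.le⟩, h0⟩
      gcongr
  refine ⟨lam, ⟨⟨hlam1, hlaml⟩, hlam0⟩, fun z hz hz0 =>
    C_zero_unique h hp hZ1 hZtwo hz ⟨hlam1, hlaml⟩ hz0 hlam0, fun n hn => ?_⟩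
  have hzero : 1 - lam * altSeries a 0 lam = 0 := by rw [← C_eq, hlam0]
  have hq := q_eq_sum (x := x) hmeas hstat hdep
  have e1 := abs_q_mul_pow_sub_q_three_le h hp hp1 h2 hlam1.le (by linarith) hzero hq hn
  have e2 := abs_q_three_mul_pow_sub_le h hp hp1 h2 hlam1.le hlamY hzero hq
  refine (abs_sub_le _ (q μ X x 3 * lam ^ 3) _).trans ((add_le_add e1 e2).trans ?_)
  rw [← add_mul]
  exact mul_le_mul_of_nonneg_right (by linarith) (pow_nonneg hp.le 3)
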